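/- Let $p\ge 1$, let $(\Xi_1,\rho_1),\dots,(\Xi_n,\rho_n)$ be complete separable metric spaces with their Borel $\sigma$-algebras, and let $\Xi=\Xi_1\times\cdots\times\Xi_n$. Let $\boldsymbol{\varepsilon}=(\varepsilon_1,\dots,\varepsilon_n)$ with $\varepsilon_k\ge 0$, and let $Q=Q_1\otimes\cdots\otimes Q_n$ be a product of probability measures $Q_k$ on $\Xi_k$ with finite $p$-th moment, i.e. $Q_k\in\mathcal P_p(\Xi_k)$. For probability measures $\mu,\nu$ on $\Xi_k$ let $$W_p(\mu,\nu)=\inf_{\pi}\Big\{\int_{\Xi_k\times\Xi_k}\rho_k(\zeta,\xi)^p\,d\pi(\zeta,\xi)\Big\}^{1/p},$$ the infimum being over all probability measures $\pi$ on $\Xi_k\times\Xi_k$ with first marginal $\mu$ and second marginal $\nu$, and let $\mathcal B_p(Q_k,\varepsilon_k)=\{P_k\in\mathcal P_p(\Xi_k): W_p(Q_k,P_k)\le\varepsilon_k\}$. Define the Wasserstein hyperrectangle $$\mathcal H_p(Q,\boldsymbol{\varepsilon})=\{P_1\otimes\cdots\otimes P_n:\ P_k\in\mathcal B_p(Q_k,\varepsilon_k)\text{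 for all }k\}$$ and the multi-transport hyperrectangle $\mathcal T_p(Q,\boldsymbol{\varepsilon})$ as the set of second marginals of all probability measures $\pi$ on $\Xi\times\Xi$ that have first marginal $Q$ and satisfy $$\int_{\Xi\times\Xi}\rho_k(\zeta_k,\xi_k)^p\,d\pi(\zeta,\xi)\le\varepsilon_k^p\quad\text{for all }k=1,\dots,n.$$ Then $\mathcal H_p(Q,\boldsymbol{\varepsilon})\subset\mathcal T_p(Q,\boldsymbol{\varepsilon})$. Conversely, every product distribution $P=P_1\otimes\cdots\otimes P_n$ (with $P_k$ probability measures on $\Xi_k$) that belongs to $\mathcal T_p(Q,\boldsymbol{\varepsilon})$ also belongs to $\mathcal H_p(Q,\boldsymbol{\varepsilon})$. -/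

import Mathlib

open MeasureTheory
open scoped NNReal ENNReal

namespace AmbiguitySets

section Ball

variable {X : Type*} [MetricSpace X] [MeasurableSpace X]

/-- `P ∈ 𝒫_p(X)`: the probability measure `P` has finite `p`-th moment. -/
def HasFiniteMoment (p : ℝ) (P : ProbabilityMeasure X) : Prop :=
  ∃ x₀ : X, ∫⁻ x, ((nndist x₀ x ^ p : ℝ≥0) : ℝ≥0∞) ∂(P : Measure X) < ∞

/-- The transport plans `𝒞(Q, P)`: distributions on `X × X` with first marginal `Q` and second
marginal `P`. -/
def couplings (Q P : ProbabilityMeasure X) : Set (ProbabilityMeasure (X × X)) :=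
  {π | (π : Measure (X × X)).map Prod.fst = (Q : Measure X) ∧
    (π : Measure (X × X)).map Prod.snd = (P : Measure X)}

/-- The `p`-th Wasserstein distance `W_p(Q, P)`, as an extended nonnegative number. -/
noncomputable def wassersteinDist (p : ℝ) (Q P : ProbabilityMeasure X) : ℝ≥0∞ :=
  ⨅ π ∈ couplings Q P,
    (∫⁻ z, ((nndist z.1 z.2 ^ p : ℝ≥0) : ℝ≥0∞) ∂(π : Measure (X × X))) ^ (1 / p)

/-- The Wasserstein ball `ℬ_p(Q, ε) = {P ∈ 𝒫_p(X) : W_p(Q, P) ≤ ε}`. -/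
def wassersteinBall (p : ℝ) (Q : ProbabilityMeasure X) (ε : ℝ≥0) : Set (ProbabilityMeasure X) :=
  {P | HasFiniteMoment p P ∧ wassersteinDist p Q P ≤ ε}

end Ball

section MultiTransport

variable {X ι : Type*} [MeasurableSpace X]

/-- The set `Π(Q)` of distributions on `X × X` with first marginal `Q`. -/
def plansFrom (Q : ProbabilityMeasure X) : Set (ProbabilityMeasure (X × X)) :=
  {π | (π : Measure (X × X)).map Prod.fst = (Q : Measure X)}

/-- The set `Π(Q, ϵ; c)` of plans starting from `Q` that respect every transport budget:
`∫ c k dπ ≤ ϵ k` for all `k`. -/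
def budgetPlans (Q : ProbabilityMeasure X) (c : ι → X × X → ℝ≥0) (ϵ : ι → ℝ≥0) :
    Set (ProbabilityMeasure (X × X)) :=
  {π | π ∈ plansFrom Q ∧
    ∀ k, ∫⁻ z, (c k z : ℝ≥0∞) ∂(π : Measure (X × X)) ≤ (ϵ k : ℝ≥0∞)}

/-- The multi-transport hyperrectangle `𝒯(Q, ϵ)`: second marginals of the plans in
`Π(Q, ϵ; c)`. -/
def multiTransport (Q : ProbabilityMeasure X) (c : ι → X × X → ℝ≥0) (ϵ : ι → ℝ≥0) :
    Set (ProbabilityMeasure X) :=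
  {P | ∃ π ∈ budgetPlans Q c ϵ, (π : Measure (X × X)).map Prod.snd = (P : Measure X)}

end MultiTransport

section Hyperrectangles

variable {n : ℕ} {Ξ : Fin n → Type*} [∀ k, MeasurableSpace (Ξ k)]

/-- `P` is a product distribution `P_1 ⊗ ⋯ ⊗ P_n`. -/
def IsProductDistribution (P : ProbabilityMeasure (∀ k, Ξ k)) : Prop :=
  ∃ R : ∀ k, ProbabilityMeasure (Ξ k), P = ProbabilityMeasure.pi R

variable [∀ k, MetricSpace (Ξ k)]

/-- The Wasserstein hyperrectangle `ℋ_p(Q_1 ⊗ ⋯ ⊗ Q_n, ε)`, given through the factors `Q k`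
(which are the marginals of the product, hence determined by it). -/
def wassersteinHyperrectangle (p : ℝ) (Q : ∀ k, ProbabilityMeasure (Ξ k)) (ε : Fin n → ℝ≥0) :
    Set (ProbabilityMeasure (∀ k, Ξ k)) :=
  {P | ∃ R : ∀ k, ProbabilityMeasure (Ξ k),
    (∀ k, R k ∈ wassersteinBall p (Q k) (ε k)) ∧ P = ProbabilityMeasure.pi R}

/-- The multi-transport hyperrectangle `𝒯_p(Q, ε) = 𝒯(Q, ε^p)` for the costs
`c_k(ζ, ξ) = ρ_k(ζ_k, ξ_k)^p`. -/
noncomputable def multiTransportHyperrectangle (p : ℝ) (Q : ProbabilityMeasure (∀ k, Ξ k))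
    (ε : Fin n → ℝ≥0) : Set (ProbabilityMeasure (∀ k, Ξ k)) :=
  multiTransport Q (fun k z => nndist (z.1 k) (z.2 k) ^ p) (fun k => ε k ^ p)

end Hyperrectangles

end AmbiguitySets

/-! Both inclusions pass between plans on the factors and plans on the product. Given optimal
couplings `π k` of `Q k` and `R k`, the product of the `π k`, with coordinates regrouped, transports
the product of the `Q k` to the product of the `R k` at cost exactly that of `π k` in coordinate
`k`. Conversely, projecting a plan to its `k`-th pair of coordinates couples the `k`-th marginals at
the same cost. The budgets leave no slack, so the infimum in `wassersteinDist` must be attained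
(`exists_coupling_cost_le`): the cost is lower semicontinuous and `couplings Q P` is weakly compact.
-/

namespace AmbiguitySets

section Attainment

/-- The integral of a continuous nonnegative function is a lower semicontinuous function of the
probability measure. -/
theorem lowerSemicontinuous_lintegral_of_continuous {Y : Type*} [TopologicalSpace Y]
    [MeasurableSpace Y] [OpensMeasurableSpace Y] {f : Y → ℝ≥0} (hf : Continuous f) :
    LowerSemicontinuous fun π : ProbabilityMeasure Y =>
      ∫⁻ y, (f y : ℝ≥0∞) ∂(π : Measure Y) := by
  -- The truncations `min f m` have weakly continuous integrals; by monotone convergence the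
  -- integral of `f` is their supremum.
  let g : ℕ → BoundedContinuousFunction Y ℝ≥0 := fun m =>
    ⟨⟨fun y => min (f y) m, by fun_prop⟩, ⟨m, fun x y => by
      rw [NNReal.dist_eq, abs_le]
      have hx : ((min (f x) m : ℝ≥0) : ℝ) ≤ m := by exact_mod_cast min_le_right (f x) (m : ℝ≥0)
      have hy : ((min (f y) m : ℝ≥0) : ℝ) ≤ m := by exact_mod_cast min_le_right (f y) (m : ℝ≥0)
      have hx0 := (min (f x) (m : ℝ≥0)).coe_nonneg
      have hy0 := (min (f y) (m : ℝ≥0)).coe_nonneg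
      constructor <;> dsimp only <;> linarith⟩⟩
  have hsup : ∀ y, (f y : ℝ≥0∞) = ⨆ m, (g m y : ℝ≥0∞) := by
    intro y
    refine le_antisymm ?_ (iSup_le fun m => ?_)
    · obtain ⟨m, hm⟩ := exists_nat_ge (f y)
      refine le_iSup_of_le m ?_
      have : g m y = f y := min_eq_left hm
      rw [this]
    · exact ENNReal.coe_le_coe.2 (min_le_left _ _)
  have hint : ∀ π : ProbabilityMeasure Y,
      ∫⁻ y, (f y : ℝ≥0∞) ∂(π : Measure Y) = ⨆ m, ∫⁻ y, (g m y : ℝ≥0∞) ∂(π : Measure Y) := by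
    intro π
    simp_rw [hsup]
    refine lintegral_iSup (fun m => (g m).continuous.measurable.coe_nnreal_ennreal) ?_
    intro a b hab y
    exact ENNReal.coe_le_coe.2 (min_le_min_left _ (by exact_mod_cast hab))
  simp_rw [hint]
  exact lowerSemicontinuous_iSup fun m =>
    (ProbabilityMeasure.continuous_lintegral_boundedContinuousFunction (g m)).lowerSemicontinuous

variable {X : Type*} [MeasurableSpace X]

theorem prod_mem_couplings (Q P : ProbabilityMeasure X) : Q.prod P ∈ couplings Q P := by
  constructor <;> simp [ProbabilityMeasure.toMeasure_prod]

variable [MetricSpace X] [SecondCountableTopology X] [BorelSpace X]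

theorem isClosed_couplings (Q P : ProbabilityMeasure X) : IsClosed (couplings Q P) := by
  have h1 := ProbabilityMeasure.continuous_map (continuous_fst (X := X) (Y := X))
  have h2 := ProbabilityMeasure.continuous_map (continuous_snd (X := X) (Y := X))
  have : couplings Q P =
      {π | π.map (continuous_fst (X := X) (Y := X)).measurable.aemeasurable = Q} ∩
      {π | π.map (continuous_snd (X := X) (Y := X)).measurable.aemeasurable = P} := by
    ext π
    simp only [couplings, Set.mem_inter_iff, Set.mem_ofPred_eq,
      ← ProbabilityMeasure.toMeasure_injective.eq_iff, ProbabilityMeasure.toMeasure_map]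
  rw [this]
  exact (isClosed_eq h1 continuous_const).inter (isClosed_eq h2 continuous_const)

variable [CompleteSpace X]

/-- `Q` and `P` are each tight on a Polish space, and the mass of a coupling outside `K ×ˢ L` is
bounded through its marginals alone, hence uniformly. -/
theorem isTightMeasureSet_couplings (Q P : ProbabilityMeasure X) :
    IsTightMeasureSet {(π : Measure (X × X)) | π ∈ couplings Q P} := by
  rw [isTightMeasureSet_iff_exists_isCompact_measure_compl_le]
  intro δ hδ
  have hδ2 : 0 < δ / 2 := ENNReal.half_pos hδ.ne'
  obtain ⟨K, hK, hQK⟩ := isTightMeasureSet_iff_exists_isCompact_measure_compl_le.1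
    (isTightMeasureSet_singleton (μ := (Q : Measure X))) _ hδ2
  obtain ⟨L, hL, hPL⟩ := isTightMeasureSet_iff_exists_isCompact_measure_compl_le.1
    (isTightMeasureSet_singleton (μ := (P : Measure X))) _ hδ2
  refine ⟨K ×ˢ L, hK.prod hL, ?_⟩
  rintro _ ⟨π, ⟨h1, h2⟩, rfl⟩
  have hsub : (K ×ˢ L)ᶜ ⊆ Prod.fst ⁻¹' Kᶜ ∪ Prod.snd ⁻¹' Lᶜ := by
    rw [Set.compl_prod_eq_union]
    rintro z (hz | hz)
    · exact Or.inl hz.1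
    · exact Or.inr hz.2
  calc (π : Measure (X × X)) (K ×ˢ L)ᶜ
      ≤ (π : Measure (X × X)) (Prod.fst ⁻¹' Kᶜ) + (π : Measure (X × X)) (Prod.snd ⁻¹' Lᶜ) :=
        (measure_mono hsub).trans (measure_union_le _ _)
    _ = (Q : Measure X) Kᶜ + (P : Measure X) Lᶜ := by
        rw [← h1, ← h2, Measure.map_apply measurable_fst hK.measurableSet.compl,
          Measure.map_apply measurable_snd hL.measurableSet.compl]
    _ ≤ δ / 2 + δ / 2 := add_le_add (hQK _ rfl) (hPL _ rfl)
    _ = δ := ENNReal.add_halves δ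

/-- Prokhorov's theorem, combined with closedness. -/
theorem isCompact_couplings (Q P : ProbabilityMeasure X) : IsCompact (couplings Q P) := by
  have := isCompact_closure_of_isTightMeasureSet (isTightMeasureSet_couplings Q P)
  rwa [(isClosed_couplings Q P).closure_eq] at this

/-- The infimum defining the Wasserstein distance is attained. -/
theorem exists_coupling_cost_le {p : ℝ} (hp : 1 ≤ p) {Q P : ProbabilityMeasure X} {ε : ℝ≥0}
    (h : wassersteinDist p Q P ≤ ε) :
    ∃ π ∈ couplings Q P,
      ∫⁻ z, ((nndist z.1 z.2 ^ p : ℝ≥0) : ℝ≥0∞) ∂(π : Measure (X × X)) ≤ ((ε ^ p : ℝ≥0) : ℝ≥0∞) := by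
  have hp0 : 0 < p := by linarith
  have hcont : Continuous fun z : X × X => nndist z.1 z.2 ^ p :=
    (NNReal.continuous_rpow_const hp0.le).comp continuous_nndist
  obtain ⟨π, hπ, hmin⟩ := LowerSemicontinuousOn.exists_isMinOn
    ⟨_, prod_mem_couplings Q P⟩ (isCompact_couplings Q P)
    ((lowerSemicontinuous_lintegral_of_continuous hcont).lowerSemicontinuousOn _)
  refine ⟨π, hπ, ?_⟩
  have hle : (∫⁻ z, ((nndist z.1 z.2 ^ p : ℝ≥0) : ℝ≥0∞) ∂(π : Measure (X × X))) ^ (1 / p) ≤ ε := by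
    refine le_trans ?_ h
    exact le_iInf₂ fun π' hπ' => ENNReal.rpow_le_rpow (hmin hπ') (by positivity)
  rw [one_div] at hle
  rw [ENNReal.coe_rpow_of_nonneg _ hp0.le]
  exact (ENNReal.rpow_inv_le_iff hp0).1 hle

end Attainment

section Moments

variable {X : Type*} [MetricSpace X] [MeasurableSpace X] [BorelSpace X]

/-- A measure at finite transport cost from one with finite `p`-th moment has finite `p`-th
moment. -/
theorem HasFiniteMoment.of_coupling {p : ℝ} (hp : 1 ≤ p) {Q P : ProbabilityMeasure X}
    (hQ : HasFiniteMoment p Q) {π : ProbabilityMeasure (X × X)} (hπ : π ∈ couplings Q P)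
    (hcost : ∫⁻ z, ((nndist z.1 z.2 ^ p : ℝ≥0) : ℝ≥0∞) ∂(π : Measure (X × X)) < ∞) :
    HasFiniteMoment p P := by
  have hp0 : 0 ≤ p := by linarith
  obtain ⟨x₀, hx₀⟩ := hQ
  have hmeas : Measurable fun x : X => ((nndist x₀ x ^ p : ℝ≥0) : ℝ≥0∞) :=
    ((NNReal.continuous_rpow_const hp0).comp
      (continuous_const.nndist continuous_id)).measurable.coe_nnreal_ennreal
  refine ⟨x₀, ?_⟩
  rw [← hπ.1, lintegral_map hmeas measurable_fst] at hx₀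
  rw [← hπ.2, lintegral_map hmeas measurable_snd]
  -- The factor `2 ^ (p - 1)` comes from convexity of `t ↦ t ^ p`, applied after the triangle
  -- inequality through `z.1`.
  have hbound : ∀ z : X × X, ((nndist x₀ z.2 ^ p : ℝ≥0) : ℝ≥0∞) ≤
      (((2 : ℝ≥0) ^ (p - 1) : ℝ≥0) : ℝ≥0∞) * (((nndist x₀ z.1 ^ p : ℝ≥0) : ℝ≥0∞) +
        ((nndist z.1 z.2 ^ p : ℝ≥0) : ℝ≥0∞)) := by
    intro z
    have := (NNReal.rpow_le_rpow (nndist_triangle x₀ z.1 z.2) hp0).trans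
      (NNReal.rpow_add_le_mul_rpow_add_rpow _ _ hp)
    exact_mod_cast this
  refine (lintegral_mono hbound).trans_lt ?_
  rw [lintegral_const_mul' _ _ ENNReal.coe_ne_top,
    lintegral_add_left (f := fun z : X × X => ((nndist x₀ z.1 ^ p : ℝ≥0) : ℝ≥0∞))
      (hmeas.comp measurable_fst)]
  exact ENNReal.mul_lt_top ENNReal.coe_lt_top (ENNReal.add_lt_top.2 ⟨hx₀, hcost⟩)

theorem mem_wassersteinBall_of_coupling {p : ℝ} (hp : 1 ≤ p) {Q P : ProbabilityMeasure X}
    (hQ : HasFiniteMoment p Q) {ε : ℝ≥0} {π : ProbabilityMeasure (X × X)}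
    (hπ : π ∈ couplings Q P)
    (hcost : ∫⁻ z, ((nndist z.1 z.2 ^ p : ℝ≥0) : ℝ≥0∞) ∂(π : Measure (X × X)) ≤
      ((ε ^ p : ℝ≥0) : ℝ≥0∞)) :
    P ∈ wassersteinBall p Q ε := by
  have hp0 : 0 < p := by linarith
  refine ⟨hQ.of_coupling hp hπ (hcost.trans_lt ENNReal.coe_lt_top), iInf₂_le_of_le π hπ ?_⟩
  rw [one_div, ENNReal.rpow_inv_le_iff hp0, ← ENNReal.coe_rpow_of_nonneg _ hp0.le]
  exact hcost

end Moments

section Hyperrectangles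

variable {n : ℕ} {Ξ : Fin n → Type*} [∀ k, MeasurableSpace (Ξ k)]

theorem map_eval_pi (R : ∀ k, ProbabilityMeasure (Ξ k)) (k : Fin n) :
    (ProbabilityMeasure.pi R : Measure (∀ k, Ξ k)).map (Function.eval k) =
      (R k : Measure (Ξ k)) := by
  rw [ProbabilityMeasure.toMeasure_pi, Measure.pi_map_eval]
  simp

variable [∀ k, MetricSpace (Ξ k)] [∀ k, SecondCountableTopology (Ξ k)] [∀ k, BorelSpace (Ξ k)]

theorem measurable_nndist_rpow (p : ℝ) (k : Fin n) :
    Measurable fun z : Ξ k × Ξ k => ((nndist z.1 z.2 ^ p : ℝ≥0) : ℝ≥0∞) :=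
  (measurable_nndist.pow_const p).coe_nnreal_ennreal

theorem wassersteinHyperrectangle_subset [∀ k, CompleteSpace (Ξ k)] {p : ℝ} (hp : 1 ≤ p)
    (Q : ∀ k, ProbabilityMeasure (Ξ k)) (ε : Fin n → ℝ≥0) :
    wassersteinHyperrectangle p Q ε ⊆
      multiTransportHyperrectangle p (ProbabilityMeasure.pi Q) ε := by
  rintro _ ⟨R, hR, rfl⟩
  choose π hπ hcost using fun k => exists_coupling_cost_le hp (hR k).2
  have hunzip : Measurable fun w : ∀ k, Ξ k × Ξ k => (fun k => (w k).1, fun k => (w k).2) := by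
    fun_prop
  have hfst : ∀ k, (π k : Measure (Ξ k × Ξ k)).map Prod.fst = (Q k : Measure (Ξ k)) :=
    fun k => (hπ k).1
  have hsnd : ∀ k, (π k : Measure (Ξ k × Ξ k)).map Prod.snd = (R k : Measure (Ξ k)) :=
    fun k => (hπ k).2
  -- `Measure.pi_map_pi` needs σ-finite images.
  have : ∀ k, SigmaFinite ((π k : Measure (Ξ k × Ξ k)).map Prod.fst) := fun k => by
    rw [hfst]; infer_instance
  have : ∀ k, SigmaFinite ((π k : Measure (Ξ k × Ξ k)).map Prod.snd) := fun k => by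
    rw [hsnd]; infer_instance
  refine ⟨(ProbabilityMeasure.pi π).map hunzip.aemeasurable, ⟨?_, fun k => ?_⟩, ?_⟩
  · change Measure.map _ _ = _
    rw [ProbabilityMeasure.toMeasure_map, Measure.map_map measurable_fst hunzip,
      ProbabilityMeasure.toMeasure_pi, ProbabilityMeasure.toMeasure_pi]
    simp_rw [← hfst]
    exact Measure.pi_map_pi fun k => measurable_fst.aemeasurable
  · have hm : Measurable fun z : (∀ k, Ξ k) × (∀ k, Ξ k) =>
        ((nndist (z.1 k) (z.2 k) ^ p : ℝ≥0) : ℝ≥0∞) :=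
      (measurable_nndist_rpow p k).comp (by fun_prop :
        Measurable fun z : (∀ k, Ξ k) × (∀ k, Ξ k) => (z.1 k, z.2 k))
    rw [ProbabilityMeasure.toMeasure_map, lintegral_map hm hunzip]
    refine le_of_eq_of_le ?_ (hcost k)
    -- The `k`-th cost sees only the `k`-th factor of the product plan, which is `π k`.
    rw [← map_eval_pi π k, lintegral_map (measurable_nndist_rpow p k) (measurable_pi_apply k)]
  · rw [ProbabilityMeasure.toMeasure_map, Measure.map_map measurable_snd hunzip,
      ProbabilityMeasure.toMeasure_pi, ProbabilityMeasure.toMeasure_pi]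
    simp_rw [← hsnd]
    exact Measure.pi_map_pi fun k => measurable_snd.aemeasurable

theorem pi_mem_wassersteinHyperrectangle {p : ℝ} (hp : 1 ≤ p)
    {Q R : ∀ k, ProbabilityMeasure (Ξ k)} (hQ : ∀ k, HasFiniteMoment p (Q k))
    {ε : Fin n → ℝ≥0}
    (h : ProbabilityMeasure.pi R ∈
      multiTransportHyperrectangle p (ProbabilityMeasure.pi Q) ε) :
    ProbabilityMeasure.pi R ∈ wassersteinHyperrectangle p Q ε := by
  obtain ⟨π, ⟨hfst, hcost⟩, hsnd⟩ := h
  refine ⟨R, fun k => ?_, rfl⟩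
  have hproj : Measurable fun z : (∀ k, Ξ k) × (∀ k, Ξ k) => (z.1 k, z.2 k) := by fun_prop
  refine mem_wassersteinBall_of_coupling hp (hQ k) (π := π.map hproj.aemeasurable) ⟨?_, ?_⟩ ?_
  · rw [ProbabilityMeasure.toMeasure_map, Measure.map_map measurable_fst hproj,
      ← map_eval_pi Q k, ← (show _ = _ from hfst),
      Measure.map_map (measurable_pi_apply k) measurable_fst]
    rfl
  · rw [ProbabilityMeasure.toMeasure_map, Measure.map_map measurable_snd hproj,
      ← map_eval_pi R k, ← hsnd, Measure.map_map (measurable_pi_apply k) measurable_snd]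
    rfl
  · rw [ProbabilityMeasure.toMeasure_map, lintegral_map (measurable_nndist_rpow p k) hproj]
    exact hcost k

end Hyperrectangles

end AmbiguitySets

theorem mainTheorem5 {n : ℕ} {Ξ : Fin n → Type*}
    [∀ k, MetricSpace (Ξ k)] [∀ k, CompleteSpace (Ξ k)] [∀ k, SecondCountableTopology (Ξ k)]
    [∀ k, MeasurableSpace (Ξ k)] [∀ k, BorelSpace (Ξ k)]
    (p : ℝ) (hp : 1 ≤ p) (ε : Fin n → ℝ≥0)
    (Q : ∀ k, ProbabilityMeasure (Ξ k)) (hQ : ∀ k, AmbiguitySets.HasFiniteMoment p (Q k)) :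
    AmbiguitySets.wassersteinHyperrectangle p Q ε ⊆
        AmbiguitySets.multiTransportHyperrectangle p (ProbabilityMeasure.pi Q) ε ∧
      ∀ P ∈ AmbiguitySets.multiTransportHyperrectangle p (ProbabilityMeasure.pi Q) ε,
        AmbiguitySets.IsProductDistribution P →
          P ∈ AmbiguitySets.wassersteinHyperrectangle p Q ε := by
  refine ⟨AmbiguitySets.wassersteinHyperrectangle_subset hp Q ε, ?_⟩
  rintro _ hP ⟨R, rfl⟩
  exact AmbiguitySets.pi_mem_wassersteinHyperrectangle hp hQ hP
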